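/- Let $K$ be an algebraically closed field. For a $K$-linear map $\Psi:\bigwedge^s K^n\to F$ with $s\ge 2$ and $F$ a $K$-vector space, the nullity $null(\Psi)$ is the maximum of the dimensions of subspaces $W\subseteq K^n$ such that $\Psi(w_1\wedge w_2\wedge v_3\wedge\dots\wedge v_s)=0$ for all $w_1,w_2\in W$ and $v_3,\dots,v_s\in K^n$. Let $n,m\ge 0$ be integers. (1) If $m\le 2n-4$, then every linear map $\Phi:\bigwedge^2K^n\to K^m$ has nullity at least $2$. (2) If $n\ge 1$ and $m>2n-4$, then there exists a linear map $\Phi:\bigwedge^2K^n\to K^m$ with nullity equal to $1$. (3) If $n\ge 4$, then every linear map $\Psi:\bigwedge^3K^n\to K$ has nullity at least $2$. -/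

import Mathlib

/-- The `k`-nullity of a skew-symmetric form `Ψ : ⋀ˢ Kⁿ → F` (used for `1 ≤ k ≤ s`): the maximal
dimension of a subspace `W ⊆ Kⁿ` such that `Ψ(W, …, W, Kⁿ, …, Kⁿ) = 0`, where `W` occupies the
first `k` of the `s` arguments. -/
noncomputable def kNullity {K : Type*} [Field K] {n s : ℕ} {F : Type*} [AddCommGroup F]
    [Module K F] (k : ℕ) (Ψ : (⋀[K]^s (Fin n → K)) →ₗ[K] F) : ℕ :=
  sSup {d : ℕ | ∃ W : Submodule K (Fin n → K), Module.finrank K W = d ∧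
    ∀ v : Fin s → (Fin n → K), (∀ i : Fin s, (i : ℕ) < k → v i ∈ W) →
      Ψ (exteriorPower.ιMulti K s v) = 0}

/-- The nullity of a skew-symmetric form is its `2`-nullity. -/
noncomputable def nullity {K : Type*} [Field K] {n s : ℕ} {F : Type*} [AddCommGroup F]
    [Module K F] (Ψ : (⋀[K]^s (Fin n → K)) →ₗ[K] F) : ℕ :=
  kNullity 2 Ψ

/-- The supremum in the definition of the `k`-nullity is an attained maximum. -/
theorem kNullity_isGreatest {K : Type*} [Field K] {n s : ℕ} {F : Type*} [AddCommGroup F]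
    [Module K F] (k : ℕ) (hk : 1 ≤ k) (hks : k ≤ s) (Ψ : (⋀[K]^s (Fin n → K)) →ₗ[K] F) :
    IsGreatest {d : ℕ | ∃ W : Submodule K (Fin n → K), Module.finrank K W = d ∧
      ∀ v : Fin s → (Fin n → K), (∀ i : Fin s, (i : ℕ) < k → v i ∈ W) →
        Ψ (exteriorPower.ιMulti K s v) = 0} (kNullity k Ψ) := by
  have hb : BddAbove {d : ℕ | ∃ W : Submodule K (Fin n → K), Module.finrank K W = d ∧
      ∀ v : Fin s → (Fin n → K), (∀ i : Fin s, (i : ℕ) < k → v i ∈ W) →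
        Ψ (exteriorPower.ιMulti K s v) = 0} := by
    refine ⟨n, ?_⟩
    rintro d ⟨W, rfl, -⟩
    simpa using W.finrank_le
  refine ⟨Nat.sSup_mem ⟨0, ⊥, by simp, ?_⟩ hb, fun d hd => le_csSup hb hd⟩
  intro v hv
  have h0 : v ⟨0, by omega⟩ = 0 := by
    simpa using hv ⟨0, by omega⟩ (by simp; omega)
  rw [(exteriorPower.ιMulti K s).map_coord_zero _ h0, map_zero]

/-! (1) says that `2n - 4` hyperplanes always meet on the Grassmannian of planes, whose dimension is
`2n - 4`. Intersection theory is replaced by valuations. At a generic pair the minors generate an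
algebra of transcendence degree `2n - 3`, so they are not all integral over `m ≤ 2n - 4` linear
forms in them. A valuation ring then contains the forms but not some minor. Dividing by a largest
minor and passing to the residue field kills the forms and keeps rank two
(`exists_minorForm_eq_zero_of_not_isIntegral`); the Nullstellensatz brings this zero down to `K`.
(2) The map `e i ∧ e j ↦ e (i + j - 1)` behaves like polynomial multiplication: on a pair in echelon
form the lowest terms multiply without cancellation. (3) A 3-form contracts to `n` bilinear forms,
and `n ≤ 2n - 4` once `n ≥ 4`, so (1) applies. -/

/-- The relations of `z` form a proper ideal; a maximal ideal above it is a `K`-point by the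
Nullstellensatz. -/
theorem MvPolynomial.exists_eval_eq_zero_of_aeval_eq_zero {K σ Ω : Type*} [Field K] [IsAlgClosed K]
    [Finite σ] [CommRing Ω] [Nontrivial Ω] [Algebra K Ω] (z : σ → Ω) :
    ∃ w : σ → K, ∀ p : MvPolynomial σ K, MvPolynomial.aeval z p = 0 → MvPolynomial.eval w p = 0 := by
  obtain ⟨M, hM, hle⟩ := Ideal.exists_le_maximal _
    (RingHom.ker_ne_top (MvPolynomial.aeval (R := K) z).toRingHom)
  obtain ⟨w, rfl⟩ := MvPolynomial.isMaximal_iff_eq_vanishingIdeal_singleton.1 hM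
  refine ⟨w, fun p hp => ?_⟩
  have := (MvPolynomial.mem_vanishingIdeal_singleton_iff w p).1 (hle hp)
  simpa [MvPolynomial.aeval_eq_eval] using this

/-! ### Common zeros of linear forms in the minors -/

/-- The `2 × 2` minor of the pair `(x, y)` on the coordinates `i` and `j`. -/
def pairMinor {R ι : Type*} [CommRing R] (x y : ι → R) (i j : ι) : R :=
  x i * y j - x j * y i

/-- The value at `(x, y)` of the linear form in the minors with coefficients `c`. -/
def minorForm {K R ι : Type*} [CommRing K] [CommRing R] [Algebra K R] [Fintype ι]
    (c : ι → ι → K) (x y : ι → R) : R :=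
  ∑ i, ∑ j, algebraMap K R (c i j) * pairMinor x y i j

/-- The new pair is the old one under a change of basis of determinant `1 / pairMinor x y a b`. Its
entries are quotients of minors, so bounding these quotients bounds the vectors too. -/
theorem pairMinor_normalize {F ι : Type*} [Field F] (x y : ι → F) {a b : ι}
    (h : pairMinor x y a b ≠ 0) (i j : ι) :
    pairMinor (fun i => pairMinor x y a i / pairMinor x y a b)
      (fun i => pairMinor x y b i / pairMinor x y a b) i j =
      pairMinor x y i j / pairMinor x y a b := by
  have e : pairMinor (pairMinor x y a) (pairMinor x y b) i j
      = pairMinor x y i j * pairMinor x y a b := by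
    simp only [pairMinor]; ring
  rw [pairMinor] at e
  rw [pairMinor, div_mul_div_comm, div_mul_div_comm, ← sub_div, e]
  field_simp

theorem map_minorForm {K R S ι : Type*} [CommRing K] [CommRing R] [CommRing S] [Algebra K R]
    [Algebra K S] [Fintype ι] (f : R →ₐ[K] S) (c : ι → ι → K) (x y : ι → R) :
    f (minorForm c x y) = minorForm c (f ∘ x) (f ∘ y) := by
  simp [minorForm, pairMinor, map_sum]

/-- If some minor of `(x, y)` is not integral over the algebra generated by the forms, the forms
have a common zero of rank two over the algebraically closed base field. -/
theorem exists_minorForm_eq_zero_of_not_isIntegral {K F ι κ : Type*} [Field K] [IsAlgClosed K]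
    [Field F] [Algebra K F] [Fintype ι] (c : κ → ι → ι → K) (x y : ι → F) (i₀ j₀ : ι)
    (h : ¬ IsIntegral (Algebra.adjoin K (Set.range fun k => minorForm (c k) x y))
      (pairMinor x y i₀ j₀)) :
    ∃ x' y' : ι → K, (∃ a b, pairMinor x' y' a b = 1) ∧ ∀ k, minorForm (c k) x' y' = 0 := by
  set l : κ → F := fun k => minorForm (c k) x y with hl
  set s : Set F := Set.range (algebraMap K F) ∪ Set.range l with hs
  -- The integral closure of a subring of a field is the intersection of the valuation rings
  -- containing it.
  obtain ⟨V, hsV, hV⟩ : ∃ V : ValuationSubring F, s ⊆ V ∧ pairMinor x y i₀ j₀ ∉ V := by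
    by_contra! hcon
    have hmem : pairMinor x y i₀ j₀ ∈ (integralClosure (Subring.closure s) F).toSubring := by
      rw [← iInf_valuationSubring_superset]
      simp only [Subring.mem_iInf]
      exact fun V => hcon V.1 V.2
    refine h ?_
    obtain ⟨p, hp, hp0⟩ : IsIntegral (Subring.closure s) (pairMinor x y i₀ j₀) := hmem
    have hle : Subring.closure s ≤ (Algebra.adjoin K (Set.range l)).toSubring := by
      rw [Algebra.adjoin_eq_ring_closure]
    refine ⟨p.map (Subring.inclusion hle), hp.map _, ?_⟩
    rw [Polynomial.eval₂_map]
    exact hp0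
  obtain ⟨⟨a, b⟩, -, hmax⟩ := Finset.exists_max_image (Finset.univ : Finset (ι × ι))
    (fun q => V.valuation (pairMinor x y q.1 q.2)) ⟨(i₀, j₀), Finset.mem_univ _⟩
  set p := pairMinor x y a b with hp
  have h1 : 1 < V.valuation p := by
    refine lt_of_lt_of_le ?_ (hmax (i₀, j₀) (Finset.mem_univ _))
    exact not_le.1 fun hle => hV ((V.valuation_le_one_iff _).1 hle)
  have hp0 : p ≠ 0 := by
    rintro h0
    simp [h0] at h1
  have hdiv (i j : ι) : pairMinor x y i j / p ∈ V := by
    rw [← V.valuation_le_one_iff, map_div₀]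
    exact div_le_one_of_le₀ (hmax (i, j) (Finset.mem_univ _)) zero_le
  let algV : K →+* V := (algebraMap K F).codRestrict V fun r => hsV (Or.inl ⟨r, rfl⟩)
  let _ : Algebra K V := algV.toAlgebra
  let incl : V →ₐ[K] F := { V.subtype with commutes' := fun _ => rfl }
  let X : ι → V := fun i => ⟨pairMinor x y a i / p, hdiv a i⟩
  let Y : ι → V := fun i => ⟨pairMinor x y b i / p, hdiv b i⟩
  have hXY (i j : ι) : ((pairMinor X Y i j : V) : F) = pairMinor x y i j / p :=
    pairMinor_normalize x y hp0 i j
  have hform (k : κ) : ((minorForm (c k) X Y : V) : F) = l k / p := by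
    change incl (minorForm (c k) X Y) = _
    rw [map_minorForm, hl]
    simp only [minorForm, Finset.sum_div]
    refine Finset.sum_congr rfl fun i _ => Finset.sum_congr rfl fun j _ => ?_
    rw [mul_div_assoc, ← hXY]
    rfl
  let _ : Algebra K (IsLocalRing.ResidueField V) := ((IsLocalRing.residue V).comp algV).toAlgebra
  let res : V →ₐ[K] IsLocalRing.ResidueField V :=
    { IsLocalRing.residue V with commutes' := fun _ => rfl }
  -- `l k` has valuation at most `1` and `p` more than `1`, so `l k / p` lies in the maximal ideal.
  have hres (k : κ) : res (minorForm (c k) X Y) = 0 := by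
    refine (IsLocalRing.residue_eq_zero_iff _).2 ?_
    rw [V.valuation_lt_one_iff, hform, map_div₀]
    exact (div_lt_one₀ (zero_lt_one.trans h1)).2
      (((V.valuation_le_one_iff _).2 (hsV (Or.inr ⟨k, rfl⟩))).trans_lt h1)
  obtain ⟨w, hw⟩ := MvPolynomial.exists_eval_eq_zero_of_aeval_eq_zero (K := K)
    (Sum.elim (res ∘ X) (res ∘ Y))
  have hwX (k : κ) := hw (minorForm (c k) (fun i => MvPolynomial.X (Sum.inl i))
    (fun i => MvPolynomial.X (Sum.inr i)))
  -- Rank two is encoded by the equation "minor = 1", which specialization preserves.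
  have hwp := hw (pairMinor (fun i => MvPolynomial.X (Sum.inl i))
    (fun i => MvPolynomial.X (Sum.inr i)) a b - 1)
  refine ⟨w ∘ Sum.inl, w ∘ Sum.inr, ⟨a, b, ?_⟩, fun k => ?_⟩
  · have e : pairMinor X Y a b = 1 := Subtype.ext ((hXY a b).trans (div_self hp0))
    have e' := congrArg res e
    simp only [pairMinor, map_sub, map_mul, map_one, MvPolynomial.aeval_X, Sum.elim_inl,
      Sum.elim_inr, Function.comp_apply, MvPolynomial.eval_X] at e' hwp ⊢
    exact sub_eq_zero.1 (hwp (sub_eq_zero.2 e'))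
  · have e := hres k
    rw [map_minorForm] at e
    have e2 := hwX k
    rw [map_minorForm] at e2
    rw [← MvPolynomial.coe_aeval_eq_eval, RingHom.coe_coe, map_minorForm] at e2
    have e3 := e2 (by convert e using 2 <;> ext <;> simp)
    convert e3 using 2 <;> ext <;> simp

/-- A fraction field of a polynomial ring is algebraic over any domain of scalars over which the
variables are algebraic. -/
theorem MvPolynomial.isAlgebraic_fractionRing {K σ : Type*} [Field K]
    (D : Subalgebra K (FractionRing (MvPolynomial σ K)))
    (h : ∀ i : σ, IsAlgebraic D (algebraMap (MvPolynomial σ K) (FractionRing (MvPolynomial σ K))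
      (MvPolynomial.X i))) :
    Algebra.IsAlgebraic D (FractionRing (MvPolynomial σ K)) := by
  have hR (p : MvPolynomial σ K) :
      IsAlgebraic D (algebraMap _ (FractionRing (MvPolynomial σ K)) p) := by
    induction p using MvPolynomial.induction_on with
    | C a =>
      have := isAlgebraic_algebraMap (R := D) (A := FractionRing (MvPolynomial σ K))
        (algebraMap K D a)
      rwa [← IsScalarTower.algebraMap_apply, IsScalarTower.algebraMap_apply K (MvPolynomial σ K)]
        at this
    | add p q hp hq => rw [map_add]; exact hp.add hq
    | mul_X p i hp => rw [map_mul]; exact hp.mul (h i)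
  refine ⟨fun z => ?_⟩
  obtain ⟨p, q, -, rfl⟩ := IsFractionRing.div_surjective (A := MvPolynomial σ K) z
  rw [div_eq_mul_inv]
  exact (hR p).mul (hR q).inv

/-- At most `2 r` linear forms in the minors have a common zero of rank two in `K ^ (r + 2)`. -/
theorem exists_minorForm_eq_zero.{u} {K : Type u} [Field K] [IsAlgClosed K] {m r : ℕ} (hm : m ≤ 2 * r)
    (c : Fin m → Fin (r + 2) → Fin (r + 2) → K) :
    ∃ x y : Fin (r + 2) → K, (∃ a b, pairMinor x y a b = 1) ∧ ∀ k, minorForm (c k) x y = 0 := by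
  let σ := Option (Fin r ⊕ Fin r)
  let F := FractionRing (MvPolynomial σ K)
  let X : σ → F := fun i => algebraMap (MvPolynomial σ K) F (MvPolynomial.X i)
  -- A generic point of the cone over the big cell. With `t = X none`, its minors include `t`, minus
  -- the entries of `x`, and `t` times those of `y`, so they recover all `2r + 1` variables.
  let x : Fin (r + 2) → F := Fin.cons (X none) (Fin.cons 0 fun i => X (some (Sum.inl i)))
  let y : Fin (r + 2) → F := Fin.cons 0 (Fin.cons 1 fun i => X (some (Sum.inr i)))
  set s : Set F := Set.range fun k => minorForm (c k) x y with hs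
  obtain ⟨i, j, hij⟩ : ∃ i j, ¬ IsIntegral (Algebra.adjoin K s) (pairMinor x y i j) := by
    by_contra! hcon
    have halg (i j) : IsAlgebraic (Algebra.adjoin K s) (pairMinor x y i j) :=
      (hcon i j).isAlgebraic
    have hX0 : X none ≠ 0 := by
      simp [X]
    have ht : IsAlgebraic (Algebra.adjoin K s) (X none) := by
      simpa [pairMinor, x, y] using halg 0 1
    have : Algebra.IsAlgebraic (Algebra.adjoin K s) F := by
      refine MvPolynomial.isAlgebraic_fractionRing _ ?_
      rintro (_ | i | i)
      · exact ht
      · change IsAlgebraic _ (X _)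
        have hx : x i.succ.succ = X (some (Sum.inl i)) := rfl
        have h0 : x 1 = 0 := rfl
        have h1 : y 1 = 1 := rfl
        have e : -pairMinor x y 1 i.succ.succ = X (some (Sum.inl i)) := by
          rw [pairMinor, hx, h0, h1]; ring
        exact e ▸ (halg 1 i.succ.succ).neg
      · change IsAlgebraic _ (X _)
        have := (halg 0 i.succ.succ).mul ht.inv
        have hy : y i.succ.succ = X (some (Sum.inr i)) := rfl
        have h0 : x 0 = X none := rfl
        have h1 : y 0 = 0 := rfl
        rw [pairMinor, hy, h0, h1, mul_zero, sub_zero, mul_comm, inv_mul_cancel_left₀ hX0] at this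
        exact this
    have h1 : Algebra.trdeg K F ≤ Cardinal.mk s := Algebra.IsAlgebraic.trdeg_le_cardinalMk K s
    have h2 : Cardinal.lift.{0} (Cardinal.mk s) ≤ Cardinal.lift (Cardinal.mk (Fin m)) :=
      Cardinal.mk_range_le_lift
    have hind : AlgebraicIndependent K X :=
      (MvPolynomial.algebraicIndependent_X σ K).map' (f := IsScalarTower.toAlgHom K _ F)
        (IsFractionRing.injective (MvPolynomial σ K) F)
    have h3 := hind.lift_cardinalMk_le_trdeg
    have h4 : ((2 * r + 1 : ℕ) : Cardinal.{u}) ≤ (m : Cardinal.{u}) := by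
      have := h3.trans (Cardinal.lift_le.2 h1)
      simp only [Cardinal.lift_id', Cardinal.mk_fin, Cardinal.lift_natCast] at this h2
      have := this.trans h2
      simp [σ] at this
      rw [two_mul]
      exact_mod_cast this
    have := Nat.cast_le.1 h4
    omega
  exact exists_minorForm_eq_zero_of_not_isIntegral c x y i j hij

/-! ### Alternating maps in coordinates -/

/-- The alternating map whose components are the linear forms in the minors given by `c`. -/
def minorAlternatingMap {K ι κ : Type*} [Field K] [Fintype ι] (c : κ → ι → ι → K) :
    (ι → K) [⋀^Fin 2]→ₗ[K] (κ → K) :=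
  AlternatingMap.pi fun k => ∑ i, ∑ j,
    c k i j • Matrix.detRowAlternating.compLinearMap (LinearMap.funLeft K K ![i, j])

theorem minorAlternatingMap_apply {K ι κ : Type*} [Field K] [Fintype ι] (c : κ → ι → ι → K)
    (v : Fin 2 → ι → K) (k : κ) :
    minorAlternatingMap c v k = minorForm (c k) (v 0) (v 1) := by
  have hsum {α : Type _} (t : Finset α) (f : α → (ι → K) [⋀^Fin 2]→ₗ[K] K) :
      (∑ a ∈ t, f a) v = ∑ a ∈ t, f a v :=
    map_sum (AddMonoidHom.mk' (fun g : (ι → K) [⋀^Fin 2]→ₗ[K] K => g v) fun _ _ => rfl) f t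
  rw [minorAlternatingMap, AlternatingMap.pi_apply, hsum]
  refine Finset.sum_congr rfl fun i _ => ?_
  rw [hsum]
  exact Finset.sum_congr rfl fun j _ => congrArg (c k i j * ·) (Matrix.det_fin_two _)

theorem minorAlternatingMap_single {K ι κ : Type*} [Field K] [Fintype ι] [DecidableEq ι]
    (c : κ → ι → ι → K) (p q : ι) (k : κ) :
    minorAlternatingMap c ![Pi.single p 1, Pi.single q 1] k = c k p q - c k q p := by
  rw [minorAlternatingMap_apply]
  simp [minorForm, pairMinor, mul_sub, Finset.sum_sub_distrib, Pi.single_apply]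

theorem AlternatingMap.map_pair_swap {R M N : Type*} [CommRing R] [AddCommGroup M] [Module R M]
    [AddCommGroup N] [Module R N] (g : M [⋀^Fin 2]→ₗ[R] N) (x y : M) :
    g ![y, x] = -g ![x, y] := by
  rw [← g.map_swap ![x, y] (zero_ne_one (α := Fin 2))]
  congr 1
  funext i
  fin_cases i <;> rfl

theorem AlternatingMap.exists_minorAlternatingMap_eq {K κ : Type*} [Field K] {n : ℕ}
    (g : (Fin n → K) [⋀^Fin 2]→ₗ[K] (κ → K)) :
    ∃ c : κ → Fin n → Fin n → K, minorAlternatingMap c = g := by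
  -- Only `c k p q - c k q p` matters; the strictly upper triangular choice avoids dividing by `2`.
  let c : κ → Fin n → Fin n → K := fun k i j =>
    if i < j then g ![Pi.single i 1, Pi.single j 1] k else 0
  have hc (p q : Fin n) (hpq : p ≠ q) (k : κ) :
      minorAlternatingMap c ![Pi.single p 1, Pi.single q 1] k =
        g ![Pi.single p 1, Pi.single q 1] k := by
    rw [minorAlternatingMap_single]
    rcases hpq.lt_or_gt with h | h
    · simp only [c, if_pos h, if_neg h.le.not_gt, sub_zero]
    · simp only [c, if_pos h, if_neg h.le.not_gt, zero_sub]
      rw [g.map_pair_swap, Pi.neg_apply, neg_neg]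
  refine ⟨c, Module.Basis.ext_alternating (Pi.basisFun K (Fin n)) fun v hv => ?_⟩
  have hvec : (fun i => Pi.basisFun K (Fin n) (v i)) =
      ![Pi.single (v 0) (1 : K), Pi.single (v 1) (1 : K)] := by
    funext i
    fin_cases i <;> simp
  rw [hvec]
  exact funext (hc _ _ (hv.ne zero_ne_one))

/-- An alternating map from pairs in `K ^ n` to `K ^ m` with `m ≤ 2 n - 4` vanishes on some
linearly independent pair. -/
theorem AlternatingMap.exists_pairMinor_eq_one {K : Type*} [Field K] [IsAlgClosed K] {m n : ℕ}
    (hm : m + 4 ≤ 2 * n) (g : (Fin n → K) [⋀^Fin 2]→ₗ[K] (Fin m → K)) :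
    ∃ x y : Fin n → K, (∃ a b, pairMinor x y a b = 1) ∧ g ![x, y] = 0 := by
  obtain ⟨r, rfl⟩ : ∃ r, n = r + 2 := ⟨n - 2, by omega⟩
  obtain ⟨c, rfl⟩ := g.exists_minorAlternatingMap_eq
  obtain ⟨x, y, hab, h⟩ := exists_minorForm_eq_zero (by omega) c
  refine ⟨x, y, hab, funext fun k => ?_⟩
  rw [minorAlternatingMap_apply]
  exact h k

/-! ### Bounds on the nullity and the extremal example -/

theorem two_le_nullity {K F : Type*} [Field K] [AddCommGroup F] [Module K F] {n s : ℕ}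
    (Ψ : (⋀[K]^(s + 2) (Fin n → K)) →ₗ[K] F) (x y : Fin n → K) {a b : Fin n}
    (hab : pairMinor x y a b = 1)
    (h : ∀ v : Fin (s + 2) → (Fin n → K), v 0 = x → v 1 = y →
      Ψ (exteriorPower.ιMulti K (s + 2) v) = 0) :
    2 ≤ nullity Ψ := by
  refine (kNullity_isGreatest 2 (by norm_num) (by omega) Ψ).2
    ⟨Submodule.span K (Set.range ![x, y]), ?_, fun v hv => ?_⟩
  · have hli : LinearIndependent K ![x, y] := by
      refine LinearIndependent.pair_iff.2 fun p q hpq => ?_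
      have ha := congrFun hpq a
      have hb := congrFun hpq b
      simp only [Pi.add_apply, Pi.smul_apply, smul_eq_mul, Pi.zero_apply] at ha hb
      rw [pairMinor] at hab
      exact ⟨by linear_combination y b * ha - y a * hb - p * hab,
        by linear_combination x a * hb - x b * ha - q * hab⟩
    simpa using finrank_span_eq_card hli
  · set f := Ψ.compAlternatingMap (exteriorPower.ιMulti K (s + 2)) with hf
    change f v = 0
    have h01 : (0 : Fin (s + 2)) ≠ 1 := by simp
    have hspan (i : Fin (s + 2)) (hi : (i : ℕ) < 2) : ∃ p q : K, p • x + q • y = v i := by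
      have := hv i hi
      rwa [Matrix.range_cons, Matrix.range_cons, Matrix.range_empty, Set.union_empty,
        Set.singleton_union, Submodule.mem_span_pair] at this
    obtain ⟨p, q, h0⟩ := hspan 0 (by simp)
    obtain ⟨p', q', h1⟩ := hspan 1 (by simp)
    -- Expanding both slots leaves four terms: two repeat a vector, the others are `(x, y)` and its
    -- swap.
    have key : v = Function.update (Function.update v 0 (p • x + q • y)) 1 (p' • x + q' • y) := by
      rw [h0, h1, Function.update_eq_self, Function.update_eq_self]
    have hxy : f (Function.update (Function.update v 0 x) 1 y) = 0 :=
      h _ (by simp [h01]) (by simp)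
    have hself (z : Fin n → K) : f (Function.update (Function.update v 0 z) 1 z) = 0 :=
      f.map_eq_zero_of_eq _ (by simp [h01]) h01
    have hyx : f (Function.update (Function.update v 0 y) 1 x) = 0 := by
      have := f.map_swap (Function.update (Function.update v 0 x) 1 y) h01
      rw [hxy, neg_zero] at this
      convert this using 2
      ext i : 1
      rcases eq_or_ne i 0 with rfl | hi0
      · simp [h01]
      rcases eq_or_ne i 1 with rfl | hi1
      · simp [h01]
      · simp [hi0, hi1, Equiv.swap_apply_of_ne_of_ne]
    have hadd (u z z' : Fin n → K) (e e' : K) :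
        f (Function.update (Function.update v 0 u) 1 (e • z + e' • z')) =
        e • f (Function.update (Function.update v 0 u) 1 z) +
          e' • f (Function.update (Function.update v 0 u) 1 z') := by
      rw [f.map_update_add, f.map_update_smul, f.map_update_smul]
    rw [key, hadd]
    simp only [Function.update_comm h01 (_ + _), f.map_update_add, f.map_update_smul]
    simp only [← Function.update_comm h01, hxy, hyx, hself, smul_zero, add_zero]

/-- The coefficients of the map sending `e i ∧ e j` to `e (i + j - 1)` for `i < j`. -/
def antidiagonalCoeff (K : Type*) [Field K] (n m : ℕ) (k : Fin m) (i j : Fin n) : K :=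
  if i < j ∧ (i : ℕ) + j = k + 1 then 1 else 0

theorem minorForm_antidiagonalCoeff {K : Type*} [Field K] {n m : ℕ} (x y : Fin n → K)
    {i j : Fin n} (hij : i < j) (hx : ∀ a < i, x a = 0) (hy : ∀ b < j, y b = 0) (k : Fin m)
    (hk : (i : ℕ) + j = k + 1) :
    minorForm (antidiagonalCoeff K n m k) x y = x i * y j := by
  -- On `a + b = i + j` with `a < b`, a nonzero `x a * y b` forces `a = i` and `b = j`, while `y a ≠
  -- 0` would give `b > a ≥ j > i`, making the sum too large.
  have hz (a b : Fin n) (hab : a ≠ i ∨ b ≠ j) :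
      algebraMap K K (antidiagonalCoeff K n m k a b) * pairMinor x y a b = 0 := by
    rw [antidiagonalCoeff]
    split_ifs with h
    · have h1 : x a * y b = 0 := by
        rcases lt_or_ge a i with ha | ha
        · rw [hx a ha, zero_mul]
        · rw [hy b (by omega), mul_zero]
      have h2 : x b * y a = 0 := by
        rw [hy a (by omega), mul_zero]
      rw [pairMinor, h1, h2, sub_zero, mul_zero]
    · simp
  rw [minorForm, Finset.sum_eq_single i, Finset.sum_eq_single j]
  · simp [antidiagonalCoeff, hij, hk, pairMinor, hy i hij]
  · exact fun b _ hb => hz i b (Or.inr hb)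
  · simp
  · exact fun a _ ha => Finset.sum_eq_zero fun b _ => hz a b (Or.inl ha)
  · simp

/-- A subspace of dimension at least two contains two vectors in echelon form. -/
theorem Submodule.exists_echelon_pair {K : Type*} [Field K] {n : ℕ} (W : Submodule K (Fin n → K))
    (hW : 2 ≤ Module.finrank K W) :
    ∃ x ∈ W, ∃ y ∈ W, ∃ i j : Fin n, i < j ∧ (∀ a < i, x a = 0) ∧ (∀ b < j, y b = 0) ∧
      x i ≠ 0 ∧ y j ≠ 0 := by
  have hlow (y : Fin n → K) (hy : y ≠ 0) : ∃ j, y j ≠ 0 ∧ ∀ b < j, y b = 0 := by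
    obtain ⟨j, hj, hmin⟩ := WellFounded.has_min (wellFounded_lt (α := Fin n)) {j | y j ≠ 0}
      (Function.ne_iff.1 hy)
    exact ⟨j, hj, fun b hb => not_not.1 fun h => hmin b h hb⟩
  have hne : W ≠ ⊥ := by
    rintro rfl
    simp at hW
  obtain ⟨z, hz, hz0⟩ := W.exists_mem_ne_zero_of_ne_bot hne
  obtain ⟨i, ⟨x, hx, hxi⟩, hmin⟩ := WellFounded.has_min (wellFounded_lt (α := Fin n))
    {i | ∃ x ∈ W, x i ≠ 0} (by
      obtain ⟨i, hi⟩ := Function.ne_iff.1 hz0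
      exact ⟨i, z, hz, hi⟩)
  have hWi (w) (hw : w ∈ W) (a) (ha : a < i) : w a = 0 :=
    not_not.1 fun h => hmin a ⟨w, hw, h⟩ ha
  -- One coordinate cannot be injective on a space of dimension at least two.
  obtain ⟨y, hy, hy0, hyi⟩ : ∃ y ∈ W, y ≠ 0 ∧ y i = 0 := by
    by_contra! hcon
    have hinj : Function.Injective ((LinearMap.proj (R := K) (φ := fun _ : Fin n => K) i).domRestrict W) := by
      refine (injective_iff_map_eq_zero _).2 fun w hw => ?_
      by_contra hw0
      exact hcon w w.2 (fun h => hw0 (Subtype.ext h)) hw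
    have := LinearMap.finrank_le_finrank_of_injective hinj
    rw [Module.finrank_self] at this
    omega
  obtain ⟨j, hj, hjmin⟩ := hlow y hy0
  refine ⟨x, hx, y, hy, i, j, ?_, hWi x hx, hjmin, hxi, hj⟩
  refine lt_of_le_of_ne (not_lt.1 fun h => hj (hWi y hy j h)) ?_
  rintro rfl
  exact hj hyi

/-- Any line works, since two vectors on a line are dependent. -/
theorem one_le_nullity {K F : Type*} [Field K] [AddCommGroup F] [Module K F] {n s : ℕ}
    (hn : 1 ≤ n) (Ψ : (⋀[K]^(s + 2) (Fin n → K)) →ₗ[K] F) : 1 ≤ nullity Ψ := by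
  refine (kNullity_isGreatest 2 (by norm_num) (by omega) Ψ).2
    ⟨Submodule.span K {Pi.single ⟨0, hn⟩ 1}, ?_, fun v hv => ?_⟩
  · exact finrank_span_singleton (by simp)
  · obtain ⟨p, h0⟩ := Submodule.mem_span_singleton.1 (hv 0 (by simp))
    obtain ⟨q, h1⟩ := Submodule.mem_span_singleton.1 (hv 1 (by simp))
    rw [AlternatingMap.map_linearDependent, map_zero]
    intro hli
    have := (hli.comp ![0, 1] (by intro i j; fin_cases i <;> fin_cases j <;> simp))
    have h2 : v ∘ ![0, 1] = ![v 0, v 1] := by ext i; fin_cases i <;> rfl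
    rw [h2, LinearIndependent.pair_iff] at this
    obtain ⟨hq, hp⟩ := this q (-p) (by rw [← h0, ← h1, smul_smul, smul_smul, ← add_smul]; simp [mul_comm])
    have hv0 := hli.ne_zero 0
    rw [← h0, neg_eq_zero.1 hp, zero_smul] at hv0
    exact hv0 rfl

theorem mainTheorem8 (K : Type*) [Field K] [IsAlgClosed K] :
    (∀ n m : ℕ, (m : ℤ) ≤ 2 * (n : ℤ) - 4 →
      ∀ Φ : (⋀[K]^2 (Fin n → K)) →ₗ[K] (Fin m → K), 2 ≤ nullity Φ) ∧
    (∀ n m : ℕ, 1 ≤ n → 2 * (n : ℤ) - 4 < (m : ℤ) →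
      ∃ Φ : (⋀[K]^2 (Fin n → K)) →ₗ[K] (Fin m → K), nullity Φ = 1) ∧
    (∀ n : ℕ, 4 ≤ n →
      ∀ Ψ : (⋀[K]^3 (Fin n → K)) →ₗ[K] K, 2 ≤ nullity Ψ) := by
  refine ⟨fun n m hm Φ => ?_, fun n m hn hm => ?_, fun n hn Ψ => ?_⟩
  · obtain ⟨x, y, ⟨a, b, hab⟩, h⟩ := AlternatingMap.exists_pairMinor_eq_one (by omega)
      (Φ.compAlternatingMap (exteriorPower.ιMulti K 2))
    refine two_le_nullity (s := 0) Φ x y hab fun v h0 h1 => ?_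
    have hv : v = ![x, y] := by
      rw [← h0, ← h1]; ext i; fin_cases i <;> rfl
    rw [hv]
    exact h
  · refine ⟨exteriorPower.alternatingMapLinearEquiv
      (minorAlternatingMap (antidiagonalCoeff K n m)), le_antisymm ?_ (one_le_nullity (s := 0) hn _)⟩
    obtain ⟨W, hW, hzero⟩ := (kNullity_isGreatest 2 (by norm_num) le_rfl
      (exteriorPower.alternatingMapLinearEquiv
        (minorAlternatingMap (antidiagonalCoeff K n m)))).1
    rw [nullity, ← hW]
    by_contra! hlt
    obtain ⟨x, hx, y, hy, i, j, hij, hxi, hyj, hx0, hy0⟩ := W.exists_echelon_pair hlt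
    -- `i < j ≤ n - 1` gives `i + j - 1 ≤ 2n - 4 < m`.
    have hk : (i : ℕ) + j - 1 < m := by omega
    have hz := hzero ![x, y] (by intro i _; fin_cases i <;> assumption)
    rw [exteriorPower.alternatingMapLinearEquiv_apply_ιMulti] at hz
    have hz' := congrFun hz ⟨_, hk⟩
    rw [minorAlternatingMap_apply] at hz'
    change minorForm _ x y = 0 at hz'
    have hk' : (i : ℕ) + j = (⟨(i : ℕ) + j - 1, hk⟩ : Fin m) + 1 := by
      change (i : ℕ) + j = (i : ℕ) + j - 1 + 1
      omega
    rw [minorForm_antidiagonalCoeff x y hij hxi hyj _ hk'] at hz'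
    exact mul_ne_zero hx0 hy0 hz'
  · set f := Ψ.compAlternatingMap (exteriorPower.ιMulti K 3) with hf
    obtain ⟨x, y, ⟨a, b, hab⟩, h⟩ := AlternatingMap.exists_pairMinor_eq_one (by omega)
      (AlternatingMap.pi fun k : Fin n => f.curryLeft (Pi.single k 1))
    refine two_le_nullity (s := 1) Ψ x y hab fun v h0 h1 => ?_
    change f v = 0
    have hlin (z : Fin n → K) : f.curryLeft z ![x, y] = 0 := by
      induction z using Pi.single_induction with
      | zero => simp
      | add z z' hz hz' => rw [map_add, AlternatingMap.add_apply, hz, hz', add_zero]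
      | single k r =>
        have := congrFun h k
        rw [AlternatingMap.pi_apply] at this
        rw [← mul_one r, ← smul_eq_mul, Pi.single_smul, map_smul, AlternatingMap.smul_apply, this]
        simp
    -- A cyclic rotation moves the free argument `v 2` to the front, where the contraction takes it.
    have hperm := f.map_perm v (finRotate 3).symm
    have hv : v ∘ (finRotate 3).symm = Matrix.vecCons (v 2) ![x, y] := by
      rw [← h0, ← h1]; funext i; fin_cases i <;> rfl
    rw [hv, ← AlternatingMap.curryLeft_apply_apply, hlin] at hperm
    exact (smul_eq_zero_iff_eq _).1 hperm.symm
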